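/- Let $(T,\mathcal A,\mu)$ be a $\sigma$-finite measure space ($\mu$ non-negative and countably additive), let $X$ be a real Banach space, and let $cwk(X)$ (resp. $ck(X)$) be the family of nonempty convex weakly compact (resp. norm compact) subsets of $X$, with Hausdorff distance $h$. A countable partition of $T$ is a finite or infinite sequence $(A_n)$ of nonempty, pairwise disjoint measurable sets with union $T$; it is finer than $P$ if each of its members is contained in a member of $P$. (For finite sequences, the limit superior below is understood as the value at the last index.) Let $S$ be $cwk(X)$ or $ck(X)$. A multifunction $F:T\to S$ is simple-Birkhoff integrable if there is $I\in S$ such that for every $\varepsilon>0$ there is a countable partition $P_\varepsilon$ of $T$ into measurable sets of finite measure such that, for every countable partition $(A_n)$ finer than $P_\varepsilon$ and every choice of points $t_n\in A_n$, $$\limsup_{n}\, h\Big(\overline{\sum_{i=1}^n \mu(A_i)F(t_i)},\,I\Big)\le\varepsilon .$$ A function $f:T\to Y$ into a Banach space is Birkhoff integrable if for every $\varepsilon>0$ there is a countable partition $(A_n)$ of $T$ into measurable sets of finite measure such that $f$ is bounded on each $A_n$ with $\mu(A_n)>0$, all series $\sum_n f(t_n)\mu(A_n)$ with $t_n\in A_n$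 converge unconditionally, and the set of the sums of all these series has diameter less than $\varepsilon$. A multifunction $F:T\to S$ is Birkhoff integrable (Cascales–Rodríguez) if $j\circ F$ is Birkhoff integrable, where $j:S\to\ell^\infty(B_{X^*})$, $j(A)(x^*)=\sup_{a\in A}x^*(a)$, is the Rådström embedding. **Theorem.** Let $S$ be $cwk(X)$ or $ck(X)$. If $F:T\to S$ is simple-Birkhoff integrable, then $F$ is Birkhoff integrable. Moreover $j\circ F$ is then Birkhoff integrable for every Rådström embedding $j:S\to C(\Omega)$ ($\Omega$ compact Hausdorff), i.e. every map $j$ with $j(\alpha A+\beta C)=\alpha j(A)+\beta j(C)$ for $\alpha,\beta>0$, $h(A,C)=\|j(A)-j(C)\|_\infty$, $j(\mathrm{co}(A\cup C))=\max\{j(A),j(C)\}$ for all $A,C\in S$, and $j(S)$ norm closed. -/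

import Mathlib

open Set Filter MeasureTheory
open scoped ENNReal Pointwise Topology

namespace SimpleBirkhoff

section Hyperspaces

/-- `cwk(X)`: the nonempty, convex, weakly compact subsets of `X`. -/
def cwk (X : Type*) [NormedAddCommGroup X] [NormedSpace ℝ X] : Set (Set X) :=
  {A | A.Nonempty ∧ Convex ℝ A ∧ IsCompact (toWeakSpace ℝ X '' A)}

/-- `ck(X)`: the nonempty, convex, norm compact subsets of `X`. -/
def ck (X : Type*) [NormedAddCommGroup X] [NormedSpace ℝ X] : Set (Set X) :=
  {A | A.Nonempty ∧ Convex ℝ A ∧ IsCompact A}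

end Hyperspaces

section Partitions

variable {T : Type*} [MeasurableSpace T]

/-- A countable partition of `T` into measurable sets, enumerated as a sequence. Finite partitions
are included: they are padded by empty sets, which never contribute to a sum. -/
structure IsCountablePartition (A : ℕ → Set T) : Prop where
  measurableSet : ∀ n, MeasurableSet (A n)
  disjoint : Pairwise fun m n => Disjoint (A m) (A n)
  iUnion_eq : ⋃ n, A n = univ

/-- `A` is finer than `B`: each set of `A` is contained in some set of `B`. -/
def IsFiner (A B : ℕ → Set T) : Prop := ∀ n, ∃ m, A n ⊆ B m

/-- `t` chooses a point `t n ∈ A n` in every (nonempty) set of the sequence `A`. -/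
def IsChoice (A : ℕ → Set T) (t : ℕ → T) : Prop := ∀ n, (A n).Nonempty → t n ∈ A n

end Partitions

section SimpleIntegral

variable {T : Type*} [MeasurableSpace T] {X : Type*} [NormedAddCommGroup X] [NormedSpace ℝ X]

/-- The set `∑_{i<n} F(t_i) μ(A_i)`, the norm closure of the Minkowski sum. -/
def minkowskiSum (μ : Measure T) (F : T → Set X) (A : ℕ → Set T) (t : ℕ → T) (n : ℕ) : Set X :=
  closure (∑ i ∈ Finset.range n, μ.real (A i) • F (t i))

/-- Simple-Birkhoff integrability of `F` in the family `C` with respect to `μ`. The limsup of the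
Hausdorff distances is taken in `[0, ∞]`. -/
def SimpleBirkhoffIntegrable (μ : Measure T) (C : Set (Set X)) (F : T → Set X) : Prop :=
  ∃ I ∈ C, IsClosed I ∧ ∀ ε : ℝ, 0 < ε →
    ∃ P : ℕ → Set T, IsCountablePartition P ∧ (∀ n, μ (P n) < ∞) ∧
      ∀ A : ℕ → Set T, IsCountablePartition A → IsFiner A P →
        ∀ t : ℕ → T, IsChoice A t →
          limsup (fun n => Metric.hausdorffEDist (minkowskiSum μ F A t n) I) atTop
            ≤ ENNReal.ofReal ε

end SimpleIntegral

section BirkhoffIntegral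

variable {T : Type*} [MeasurableSpace T] {Y : Type*} [NormedAddCommGroup Y] [NormedSpace ℝ Y]

/-- `f` is summable with respect to the partition `A`: it is bounded on each set of positive
measure and all the series `∑ f(t_n) μ(A_n)` converge unconditionally. -/
def SummableOn (μ : Measure T) (f : T → Y) (A : ℕ → Set T) : Prop :=
  (∀ n, 0 < μ (A n) → Bornology.IsBounded (f '' A n)) ∧
    ∀ t : ℕ → T, IsChoice A t → Summable fun n => μ.real (A n) • f (t n)

/-- The set `J(f, A)` of all sums `∑ f(t_n) μ(A_n)`. -/
def birkhoffSums (μ : Measure T) (f : T → Y) (A : ℕ → Set T) : Set Y :=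
  {y | ∃ t : ℕ → T, IsChoice A t ∧ HasSum (fun n => μ.real (A n) • f (t n)) y}

/-- Birkhoff integrability of a Banach space valued function: for each `ε > 0` there is a countable
partition into sets of finite measure for which `f` is summable and `diam J(f, A) < ε`. -/
def BirkhoffIntegrable (μ : Measure T) (f : T → Y) : Prop :=
  ∀ ε : ℝ, 0 < ε → ∃ A : ℕ → Set T, IsCountablePartition A ∧ (∀ n, μ (A n) < ∞) ∧
    SummableOn μ f A ∧ Metric.ediam (birkhoffSums μ f A) < ENNReal.ofReal ε

end BirkhoffIntegral

section Embedding

variable {X : Type*} [NormedAddCommGroup X] [NormedSpace ℝ X]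

/-- The support function `x* ↦ sup {x*(a) : a ∈ A}` on the closed unit ball of the dual. -/
noncomputable def supportFun (A : Set X) (φ : Metric.closedBall (0 : StrongDual ℝ X) 1) : ℝ :=
  sSup ((φ : StrongDual ℝ X) '' A)

open Classical in
/-- The Rådström embedding `A ↦ (x* ↦ sup x*(A))` into `ℓ^∞(B_{X*})`. The value `0` is taken only
for sets whose support function is unbounded, which do not occur in `cwk(X)` or `ck(X)`; see
`supportEmbedding_apply_of_mem_cwk` and `ck_subset_cwk`. -/
noncomputable def supportEmbedding (A : Set X) :
    lp (fun _ : Metric.closedBall (0 : StrongDual ℝ X) 1 => ℝ) ∞ :=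
  if h : Memℓp (E := fun _ : Metric.closedBall (0 : StrongDual ℝ X) 1 => ℝ) (supportFun A) ∞
  then ⟨supportFun A, h⟩ else 0

theorem ck_subset_cwk : ck X ⊆ cwk X := fun _ hA =>
  ⟨hA.1, hA.2.1, hA.2.2.image (toWeakSpaceCLM ℝ X).continuous⟩

theorem exists_norm_le_of_mem_cwk {A : Set X} (hA : A ∈ cwk X) : ∃ M : ℝ, ∀ a ∈ A, ‖a‖ ≤ M := by
  have hpt : ∀ φ : StrongDual ℝ X, ∃ C, ∀ a : A,
      ‖NormedSpace.inclusionInDoubleDual ℝ X (a : X) φ‖ ≤ C := by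
    intro φ
    have hc : Continuous fun x : WeakSpace ℝ X => φ ((toWeakSpace ℝ X).symm x) :=
      WeakBilin.eval_continuous (topDualPairing ℝ X).flip φ
    obtain ⟨C, hC⟩ := (hA.2.2.image hc).isBounded.exists_norm_le
    exact ⟨C, fun a => hC _ ⟨_, ⟨a, a.2, rfl⟩, by simp⟩⟩
  obtain ⟨C, hC⟩ := banach_steinhaus hpt
  refine ⟨C, fun a ha => ?_⟩
  have h2 : ‖NormedSpace.inclusionInDoubleDual ℝ X a‖ = ‖a‖ :=
    (NormedSpace.inclusionInDoubleDualLi (E := X) ℝ).norm_map a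
  exact h2 ▸ hC ⟨a, ha⟩

theorem supportEmbedding_apply_of_mem_cwk {A : Set X} (hA : A ∈ cwk X)
    (φ : Metric.closedBall (0 : StrongDual ℝ X) 1) :
    supportEmbedding A φ = sSup ((φ : StrongDual ℝ X) '' A) := by
  obtain ⟨M, hM⟩ := exists_norm_le_of_mem_cwk hA
  have h : Memℓp (E := fun _ : Metric.closedBall (0 : StrongDual ℝ X) 1 => ℝ)
      (supportFun A) ∞ := by
    refine memℓp_infty ⟨M, ?_⟩
    rintro _ ⟨ψ, rfl⟩
    have hb : ∀ a ∈ A, |(ψ : StrongDual ℝ X) a| ≤ M := fun a ha => by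
      have h1 := (ψ : StrongDual ℝ X).le_opNorm a
      have h2 : ‖(ψ : StrongDual ℝ X)‖ ≤ 1 := mem_closedBall_zero_iff.1 ψ.2
      have h3 := hM a ha
      rw [Real.norm_eq_abs] at h1
      nlinarith [norm_nonneg a]
    obtain ⟨a₀, ha₀⟩ := hA.1
    refine abs_le.2 ⟨?_, ?_⟩
    · refine (abs_le.1 (hb a₀ ha₀)).1.trans (le_csSup ⟨M, ?_⟩ ⟨a₀, ha₀, rfl⟩)
      rintro _ ⟨a, ha, rfl⟩
      exact (abs_le.1 (hb a ha)).2
    · refine csSup_le ⟨_, a₀, ha₀, rfl⟩ ?_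
      rintro _ ⟨a, ha, rfl⟩
      exact (abs_le.1 (hb a ha)).2
  simp only [supportEmbedding, dif_pos h]
  rfl

/-- `j`, considered on the family `S` only, is a Rådström embedding of `S` into `C(Ω)`. -/
structure IsRadstromEmbedding {Ω : Type*} [TopologicalSpace Ω] [CompactSpace Ω]
    (S : Set (Set X)) (j : Set X → C(Ω, ℝ)) : Prop where
  map_add_smul : ∀ A ∈ S, ∀ C ∈ S, ∀ α β : ℝ, 0 < α → 0 < β →
    j (α • A + β • C) = α • j A + β • j C
  isometry : ∀ A ∈ S, ∀ C ∈ S, Metric.hausdorffDist A C = ‖j A - j C‖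
  isClosed_image : IsClosed (j '' S)
  map_convexHull_union : ∀ A ∈ S, ∀ C ∈ S, j (convexHull ℝ (A ∪ C)) = j A ⊔ j C

/-- Birkhoff integrability of a `cwk(X)`- or `ck(X)`-valued multifunction: `j ∘ F` is Birkhoff
integrable, where `j` is the embedding into `ℓ^∞(B_{X*})`. -/
def MultiBirkhoffIntegrable {T : Type*} [MeasurableSpace T] (μ : Measure T) (F : T → Set X) :
    Prop :=
  BirkhoffIntegrable μ fun t => supportEmbedding (F t)

end Embedding

end SimpleBirkhoff

namespace SimpleBirkhoff

/-! ### Refinements of partitions and choices of points. -/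

section Refinement

variable {T : Type*}

/-! A positively linear, nonexpansive `j` turns the hypothesis into one about `f = j ∘ F` in a
Banach space: for each `ε`, Riemann sums over fine partitions are within `ε` of `v = j I` in the
limit superior. As every enumeration of a partition is allowed, this bound passes to the net of
finite partial sums (`RiemannSumsNear.eventually_edist_le`).

One partition with fixed `ε` only gives sums that are Cauchy up to `2ε`. So take successively finer
partitions `R k` with errors tending to `0`, and cut the `i`-th set of `R 0` by `R i`. Beyond `i =
N` the result agrees with a partition finer than `R N`, so its tails are small; the part `i < N`
converges absolutely by `summable_head`, since `f` is bounded on finitely many sets of finite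
measure. Hence the series converge unconditionally, to sums near `v`. -/

theorem IsFiner.trans {A B C : ℕ → Set T} (h : IsFiner A B) (h' : IsFiner B C) : IsFiner A C := by
  intro n
  obtain ⟨m, hm⟩ := h n
  obtain ⟨k, hk⟩ := h' m
  exact ⟨k, hm.trans hk⟩

theorem exists_isChoice [Nonempty T] (A : ℕ → Set T) : ∃ t, IsChoice A t := by
  classical
  exact ⟨fun n => if h : (A n).Nonempty then h.some else Classical.arbitrary T, fun n h => by
    simp only [dif_pos h]; exact h.some_mem⟩

/-- The partition into the sets `P i ∩ R i j`. -/
def refineBy (P : ℕ → Set T) (R : ℕ → ℕ → Set T) (n : ℕ) : Set T :=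
  P n.unpair.1 ∩ R n.unpair.1 n.unpair.2

theorem isFiner_refineBy_left (P : ℕ → Set T) (R : ℕ → ℕ → Set T) : IsFiner (refineBy P R) P :=
  fun n => ⟨n.unpair.1, inter_subset_left⟩

end Refinement

/-! ### From limits superior along sequences to nets of finite sums. -/

section Rearrangement

variable {T : Type*} [MeasurableSpace T] {Y : Type*} [NormedAddCommGroup Y] [NormedSpace ℝ Y]

/-- Every partition finer than `P` has, for every choice of points, Riemann sums whose limit
superior of distances to `v` is at most `ε`. -/
def RiemannSumsNear (μ : Measure T) (f : T → Y) (v : Y) (ε : ℝ≥0∞) (P : ℕ → Set T) : Prop :=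
  ∀ A : ℕ → Set T, IsCountablePartition A → IsFiner A P → ∀ t : ℕ → T, IsChoice A t →
    limsup (fun n => edist (∑ i ∈ Finset.range n, μ.real (A i) • f (t i)) v) atTop ≤ ε

theorem RiemannSumsNear.mono {μ : Measure T} {f : T → Y} {v : Y} {ε : ℝ≥0∞} {P Q : ℕ → Set T}
    (h : RiemannSumsNear μ f v ε P) (hQ : IsFiner Q P) : RiemannSumsNear μ f v ε Q :=
  fun A hA hAQ t ht => h A hA (hAQ.trans hQ) t ht

/-- An exhausting increasing sequence of finite sets of natural numbers is the sequence of sets of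
indices that an injection `ι : ℕ → ℕ` maps below some increasing sequence `M`. -/
theorem exists_injective_lt_iff_mem {G : ℕ → Finset ℕ} (hG : Monotone G)
    (hex : ∀ i, ∃ k, i ∈ G k) :
    ∃ (ι M : ℕ → ℕ), Function.Injective ι ∧ StrictMono M ∧ ∀ i k, ι i < M k ↔ i ∈ G k := by
  classical
  -- `L k` starts the `k`-th block, long enough to hold every `i ∈ G k` at offset `i`. Each `i` goes
  -- into the block of the first `G k` containing it.
  let L : ℕ → ℕ := fun k => ∑ j ∈ Finset.range k, ((G j).sup id + 1)
  have hLs : ∀ k, L (k + 1) = L k + ((G k).sup id + 1) := fun k => Finset.sum_range_succ _ _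
  have hL : StrictMono L := strictMono_nat_of_lt_succ fun k => by rw [hLs]; omega
  let r : ℕ → ℕ := fun i => Nat.find (hex i)
  have hr : ∀ i, i ∈ G (r i) := fun i => Nat.find_spec (hex i)
  have hlt : ∀ i, L (r i) + i < L (r i + 1) := fun i => by
    have : i ≤ (G (r i)).sup id := Finset.le_sup (f := id) (hr i)
    rw [hLs]; omega
  have key : ∀ i k, L (r i) + i < L (k + 1) ↔ i ∈ G k := by
    intro i k
    constructor
    · intro h
      have h1 : r i < k + 1 := hL.lt_iff_lt.1 ((Nat.le_add_right _ _).trans_lt h)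
      exact hG (Nat.lt_succ_iff.1 h1) (hr i)
    · intro h
      have h1 : r i ≤ k := Nat.find_min' _ h
      exact (hlt i).trans_le (hL.monotone (by omega))
  refine ⟨fun i => L (r i) + i, fun k => L (k + 1), ?_, fun a b hab => hL (by omega), key⟩
  intro i i' h
  have h : L (r i) + i = L (r i') + i' := h
  have h1 : r i' ≤ r i := Nat.find_min' _ ((key i' (r i)).1 (h ▸ hlt i))
  have h2 : r i ≤ r i' := Nat.find_min' _ ((key i (r i')).1 (h ▸ hlt i'))
  rw [le_antisymm h2 h1] at h
  omega

/-- The finite sums of a partition inherit, as a net, the bound on the limit superior: all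
rearrangements of the partition satisfy the same bound. -/
theorem RiemannSumsNear.eventually_edist_le {μ : Measure T} {f : T → Y} {v : Y} {ε δ : ℝ≥0∞}
    {A : ℕ → Set T} (h : RiemannSumsNear μ f v ε A) (hεδ : ε < δ)
    (hA : IsCountablePartition A) {t : ℕ → T} (ht : IsChoice A t) :
    ∀ᶠ s : Finset ℕ in atTop, edist (∑ i ∈ s, μ.real (A i) • f (t i)) v ≤ δ := by
  classical
  by_contra hcon
  rw [eventually_atTop] at hcon
  push Not at hcon
  choose g hg hgδ using hcon
  -- Bad finite sets, each containing the previous one; adjoining `k` makes them exhaust `ℕ`.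
  let G : ℕ → Finset ℕ := fun k => Nat.rec (g ∅) (fun k s => g (s ∪ {k})) k
  have hGs : ∀ k, G (k + 1) = g (G k ∪ {k}) := fun k => rfl
  have hGm : Monotone G := monotone_nat_of_le_succ fun k => by
    rw [hGs]; exact Finset.subset_union_left.trans (hg _)
  have hGδ : ∀ k, δ < edist (∑ i ∈ G k, μ.real (A i) • f (t i)) v := by
    rintro (_ | k)
    · exact hgδ _
    · exact hgδ _
  have hex : ∀ i, ∃ k, i ∈ G k := fun i => ⟨i + 1, by
    rw [hGs]; exact hg _ (Finset.mem_union_right _ (Finset.mem_singleton_self i))⟩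
  obtain ⟨ι, M, hι, hM, hιM⟩ := exists_injective_lt_iff_mem hGm hex
  -- Rearrangement whose partial sums at the times `M k` are the bad sums; positions outside the
  -- range of `ι` hold empty sets and contribute nothing.
  let A' : ℕ → Set T := Function.extend ι A fun _ => ∅
  let t' : ℕ → T := Function.extend ι t fun _ => t 0
  have hA'ι : ∀ i, A' (ι i) = A i := fun i => hι.extend_apply _ _ _
  have ht'ι : ∀ i, t' (ι i) = t i := fun i => hι.extend_apply _ _ _
  have hA'0 : ∀ m, (¬ ∃ i, ι i = m) → A' m = ∅ := fun m hm => Function.extend_apply' _ _ _ hm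
  have hpart : IsCountablePartition A' := by
    refine ⟨fun m => ?_, fun m n hmn => ?_, ?_⟩
    · by_cases hm : ∃ i, ι i = m
      · obtain ⟨i, rfl⟩ := hm
        rw [hA'ι]; exact hA.measurableSet i
      · rw [hA'0 m hm]; exact MeasurableSet.empty
    · change Disjoint (A' m) (A' n)
      by_cases hm : ∃ i, ι i = m
      · by_cases hn : ∃ i, ι i = n
        · obtain ⟨i, rfl⟩ := hm
          obtain ⟨k, rfl⟩ := hn
          rw [hA'ι, hA'ι]
          exact hA.disjoint fun hik => hmn (congrArg ι hik)
        · rw [hA'0 n hn]; exact disjoint_bot_right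
      · rw [hA'0 m hm]; exact disjoint_bot_left
    · refine eq_univ_of_forall fun x => ?_
      obtain ⟨i, hi⟩ := mem_iUnion.1 (hA.iUnion_eq ▸ mem_univ x)
      exact mem_iUnion.2 ⟨ι i, by rwa [hA'ι]⟩
  have hfiner : IsFiner A' A := fun m => by
    by_cases hm : ∃ i, ι i = m
    · obtain ⟨i, rfl⟩ := hm
      exact ⟨i, (hA'ι i).le⟩
    · exact ⟨0, by rw [hA'0 m hm]; exact empty_subset _⟩
  have hchoice : IsChoice A' t' := fun m hne => by
    by_cases hm : ∃ i, ι i = m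
    · obtain ⟨i, rfl⟩ := hm
      rw [hA'ι] at hne ⊢
      rw [ht'ι]
      exact ht i hne
    · rw [hA'0 m hm] at hne
      exact absurd hne not_nonempty_empty
  have hsum : ∀ k, ∑ m ∈ Finset.range (M k), μ.real (A' m) • f (t' m) =
      ∑ i ∈ G k, μ.real (A i) • f (t i) := by
    intro k
    have hsub : (G k).image ι ⊆ Finset.range (M k) := by
      intro m hm
      obtain ⟨i, hi, rfl⟩ := Finset.mem_image.1 hm
      exact Finset.mem_range.2 ((hιM i k).2 hi)
    rw [← Finset.sum_subset hsub, Finset.sum_image hι.injOn]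
    · simp only [hA'ι, ht'ι]
    · intro m hm hm'
      have : A' m = ∅ := by
        refine hA'0 m ?_
        rintro ⟨i, rfl⟩
        exact hm' (Finset.mem_image_of_mem _ ((hιM i k).1 (Finset.mem_range.1 hm)))
      rw [this]; simp
  have hlt := eventually_lt_of_limsup_lt ((h A' hpart hfiner t' hchoice).trans_lt hεδ)
  obtain ⟨k, hk⟩ := (hM.tendsto_atTop.eventually hlt).exists
  rw [hsum] at hk
  exact lt_asymm hk (hGδ k)

end Rearrangement

/-! ### Birkhoff integrability in a Banach space. -/

section Core

variable {T : Type*} [MeasurableSpace T] {Y : Type*} [NormedAddCommGroup Y] [NormedSpace ℝ Y]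

/-- Moving only the point chosen in `A n` changes a finite sum by `μ(A n) (f x - f (t n))`. Both
sums lie within `δ` of `v`, so this change is at most `2δ`, uniformly in `x`. -/
theorem RiemannSumsNear.isBounded_image {μ : Measure T} {f : T → Y} {v : Y} {ε : ℝ≥0∞}
    {A : ℕ → Set T} (h : RiemannSumsNear μ f v ε A) (hε : ε < ∞)
    (hA : IsCountablePartition A) {n : ℕ} (hn : 0 < μ (A n)) (hfin : μ (A n) < ∞) :
    Bornology.IsBounded (f '' A n) := by
  classical
  obtain ⟨x₀, hx₀⟩ := nonempty_of_measure_ne_zero hn.ne'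
  have : Nonempty T := ⟨x₀⟩
  obtain ⟨t, ht⟩ := exists_isChoice A
  obtain ⟨δ, hεδ, hδ⟩ := exists_between hε
  have hpos : 0 < μ.real (A n) := ENNReal.toReal_pos hn.ne' hfin.ne
  refine (Metric.isBounded_iff_subset_closedBall (f (t n))).2
    ⟨(δ + δ).toReal / μ.real (A n), ?_⟩
  rintro _ ⟨x, hx, rfl⟩
  have ht' : IsChoice A (Function.update t n x) := fun m hm => by
    rcases eq_or_ne m n with rfl | hmn
    · simpa using hx
    · simpa [hmn] using ht m hm
  obtain ⟨s, ⟨h1, h2⟩, h3⟩ := (((h.eventually_edist_le hεδ hA ht').and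
    (h.eventually_edist_le hεδ hA ht)).and (eventually_ge_atTop {n})).exists
  have hns : n ∈ s := h3 (Finset.mem_singleton_self n)
  have hd := (edist_triangle_right _ _ v).trans (add_le_add h1 h2)
  have heq : ∑ i ∈ s, μ.real (A i) • f (Function.update t n x i) -
      ∑ i ∈ s, μ.real (A i) • f (t i) = μ.real (A n) • (f x - f (t n)) := by
    rw [← Finset.sum_sub_distrib, Finset.sum_eq_single_of_mem n hns]
    · simp [smul_sub]
    · intro m _ hmn
      simp [hmn]
  rw [edist_dist, ENNReal.ofReal_le_iff_le_toReal (by finiteness), dist_eq_norm, heq, norm_smul,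
    Real.norm_of_nonneg hpos.le] at hd
  rw [Metric.mem_closedBall, dist_eq_norm, le_div_iff₀' hpos]
  exact hd

theorem IsCountablePartition.refineBy {P : ℕ → Set T} {R : ℕ → ℕ → Set T}
    (hP : IsCountablePartition P) (hR : ∀ i, IsCountablePartition (R i)) :
    IsCountablePartition (refineBy P R) := by
  refine ⟨fun n => (hP.measurableSet _).inter ((hR _).measurableSet _), fun m n hmn => ?_, ?_⟩
  · by_cases h1 : m.unpair.1 = n.unpair.1
    · have h2 : m.unpair.2 ≠ n.unpair.2 := fun h2 => hmn <| by
        rw [← Nat.pair_unpair m, ← Nat.pair_unpair n, h1, h2]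
      change Disjoint (P m.unpair.1 ∩ R m.unpair.1 m.unpair.2) (P _ ∩ R _ _)
      rw [h1]
      exact ((hR _).disjoint h2).mono inter_subset_right inter_subset_right
    · exact (hP.disjoint h1).mono inter_subset_left inter_subset_left
  · refine eq_univ_of_forall fun x => ?_
    obtain ⟨i, hi⟩ := mem_iUnion.1 (hP.iUnion_eq ▸ mem_univ x)
    obtain ⟨k, hk⟩ := mem_iUnion.1 ((hR i).iUnion_eq ▸ mem_univ x)
    exact mem_iUnion.2 ⟨Nat.pair i k, by simpa [SimpleBirkhoff.refineBy] using ⟨hi, hk⟩⟩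

/-- A decreasing sequence of partitions with increasingly good Riemann sums. -/
theorem exists_seq_riemannSumsNear {μ : Measure T} {f : T → Y} {v : Y}
    (h : ∀ ε : ℝ, 0 < ε → ∃ P : ℕ → Set T, IsCountablePartition P ∧ (∀ n, μ (P n) < ∞) ∧
      RiemannSumsNear μ f v (ENNReal.ofReal ε) P) {ε : ℕ → ℝ} (hε : ∀ k, 0 < ε k) :
    ∃ R : ℕ → ℕ → Set T, (∀ k, IsCountablePartition (R k)) ∧ (∀ n, μ (R 0 n) < ∞) ∧
      (∀ k, RiemannSumsNear μ f v (ENNReal.ofReal (ε k)) (R k)) ∧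
      ∀ k l, k ≤ l → IsFiner (R l) (R k) := by
  choose! P hP hfin hnear using h
  let R : ℕ → ℕ → Set T := fun k => Nat.rec (P (ε 0))
    (fun k Q => refineBy Q fun _ => P (ε (k + 1))) k
  have hRs : ∀ k, R (k + 1) = refineBy (R k) fun _ => P (ε (k + 1)) := fun k => rfl
  refine ⟨R, fun k => ?_, fun n => hfin _ (hε 0) n, fun k => ?_, fun k l hkl => ?_⟩
  · induction k with
    | zero => exact hP _ (hε 0)
    | succ k ih => exact hRs k ▸ ih.refineBy fun _ => hP _ (hε _)
  · cases k with
    | zero => exact hnear _ (hε 0)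
    | succ k => exact (hnear _ (hε (k + 1))).mono fun n => ⟨n.unpair.2, inter_subset_right⟩
  · induction l, hkl using Nat.le_induction with
    | base => exact fun n => ⟨n, le_rfl⟩
    | succ l _ ih => exact (hRs l ▸ isFiner_refineBy_left _ _ : IsFiner (R (l + 1)) (R l)).trans ih

/-- The terms are dominated by a constant times the measures of disjoint pieces of the
finite-measure set `⋃ i < N, P i`. -/
theorem summable_head [CompleteSpace Y] {μ : Measure T} {f : T → Y} {P : ℕ → Set T} (hfin : ∀ n, μ (P n) < ∞)
    (hbdd : ∀ n, 0 < μ (P n) → Bornology.IsBounded (f '' P n)) {Q : ℕ → Set T}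
    (hQ : IsCountablePartition Q) {p : ℕ → ℕ} (hQP : ∀ n, Q n ⊆ P (p n)) {t : ℕ → T}
    (ht : IsChoice Q t) (N : ℕ) :
    Summable ({n | p n < N}.indicator fun n => μ.real (Q n) • f (t n)) := by
  classical
  have hM : ∀ i, ∃ M : ℝ, 0 ≤ M ∧ (0 < μ (P i) → ∀ x ∈ P i, ‖f x‖ ≤ M) := fun i => by
    by_cases hi : 0 < μ (P i)
    · obtain ⟨M, hM⟩ := (hbdd i hi).exists_norm_le
      exact ⟨max M 0, le_max_right _ _, fun _ x hx => (hM _ ⟨x, hx, rfl⟩).trans (le_max_left _ _)⟩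
    · exact ⟨0, le_rfl, fun h => absurd h hi⟩
  choose M hM0 hM using hM
  let B : Set T := ⋃ i ∈ Finset.range N, P i
  have hB : μ B < ∞ := measure_biUnion_lt_top (Finset.range N).finite_toSet fun i _ => hfin i
  have hsum : Summable fun n => (μ (Q n ∩ B)).toReal := by
    refine ENNReal.summable_toReal (ne_top_of_le_ne_top hB.ne ?_)
    have h1 := measure_iUnion (μ := μ.restrict B) hQ.disjoint hQ.measurableSet
    rw [hQ.iUnion_eq, Measure.restrict_apply_univ] at h1
    rw [h1]
    exact ENNReal.tsum_le_tsum fun n => (Measure.restrict_apply (hQ.measurableSet n)).ge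
  refine (hsum.mul_left (∑ i ∈ Finset.range N, M i)).of_norm_bounded fun n => ?_
  have h0 : 0 ≤ ∑ i ∈ Finset.range N, M i := Finset.sum_nonneg fun i _ => hM0 i
  by_cases hn : p n < N
  · rw [indicator_of_mem (by exact hn), norm_smul, Real.norm_of_nonneg measureReal_nonneg]
    have hsub : Q n ⊆ B := (hQP n).trans
      (subset_biUnion_of_mem (u := P) (Finset.mem_coe.2 (Finset.mem_range.2 hn)))
    rw [inter_eq_left.2 hsub, mul_comm]
    rcases eq_or_ne (μ (Q n)) 0 with hz | hz
    · simp [Measure.real, hz]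
    · refine mul_le_mul_of_nonneg_right ?_ measureReal_nonneg
      have hpos : 0 < μ (P (p n)) := hz.bot_lt.trans_le (measure_mono (hQP n))
      refine (hM _ hpos _ (hQP n (ht n (nonempty_of_measure_ne_zero hz)))).trans ?_
      exact Finset.single_le_sum (fun i _ => hM0 i) (Finset.mem_range.2 hn)
  · rw [indicator_of_notMem (by exact hn), norm_zero]
    exact mul_nonneg h0 ENNReal.toReal_nonneg

/-- A function whose Riemann sums over all sufficiently fine partitions are, in the limit
superior, close to a fixed vector is Birkhoff integrable. -/
theorem birkhoffIntegrable_of_riemannSumsNear [CompleteSpace Y] {μ : Measure T} {f : T → Y}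
    {v : Y} (h : ∀ ε : ℝ, 0 < ε → ∃ P : ℕ → Set T, IsCountablePartition P ∧
      (∀ n, μ (P n) < ∞) ∧ RiemannSumsNear μ f v (ENNReal.ofReal ε) P) :
    BirkhoffIntegrable μ f := by
  classical
  intro ε hε
  have hpow : ∀ k : ℕ, 0 < ε / 8 * (1 / 2 : ℝ) ^ k := fun k => by positivity
  obtain ⟨R, hR, hfin, hnear, hfiner⟩ := exists_seq_riemannSumsNear h hpow
  have hbdd : ∀ n, 0 < μ (R 0 n) → Bornology.IsBounded (f '' R 0 n) := fun n hn =>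
    (hnear 0).isBounded_image ENNReal.ofReal_lt_top (hR 0) hn (hfin n)
  -- `W 0` is the diagonal partition; `W N` is finer than `R N` and differs from `W 0` only over the
  -- sets `R 0 i` with `i < N`.
  let W : ℕ → ℕ → Set T := fun N => refineBy (R 0) fun i => R (max i N)
  have hW : ∀ N, IsCountablePartition (W N) := fun N => (hR 0).refineBy fun i => hR _
  have hWR : ∀ N, IsFiner (W N) (R N) := fun N n => by
    obtain ⟨m, hm⟩ := hfiner N (max n.unpair.1 N) (le_max_right _ _) n.unpair.2
    exact ⟨m, inter_subset_right.trans hm⟩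
  have hW0 : ∀ n, W 0 n ⊆ R 0 n.unpair.1 := fun n => inter_subset_left
  have hWeq : ∀ N n, N ≤ n.unpair.1 → W N n = W 0 n := fun N n hn => by
    simp only [W, refineBy, max_eq_left hn, Nat.max_zero]
  refine ⟨W 0, hW 0, fun n => (measure_mono (hW0 n)).trans_lt (hfin _), ⟨fun n hn => ?_, ?_⟩, ?_⟩
  · exact (hbdd _ (hn.trans_le (measure_mono (hW0 n)))).subset (image_mono (hW0 n))
  · intro t ht
    rw [summable_iff_vanishing_norm]
    intro δ hδ
    obtain ⟨N, hN⟩ : ∃ N : ℕ, ε / 8 * (1 / 2 : ℝ) ^ N < δ / 4 := by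
      obtain ⟨N, hN⟩ := exists_pow_lt_of_lt_one (show 0 < δ / 4 / (ε / 8) by positivity)
        (show (1 / 2 : ℝ) < 1 by norm_num)
      exact ⟨N, by rwa [lt_div_iff₀' (by positivity)] at hN⟩
    have : Nonempty T := ⟨t 0⟩
    obtain ⟨t₁, ht₁⟩ := exists_isChoice (W N)
    -- The choice `t` fits `W 0`, so its points must be replaced where `W N` differs.
    let t' : ℕ → T := fun n => if N ≤ n.unpair.1 then t n else t₁ n
    have ht' : IsChoice (W N) t' := fun n hn => by
      by_cases hNn : N ≤ n.unpair.1
      · simp only [t', if_pos hNn]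
        rw [hWeq N n hNn] at hn ⊢
        exact ht n hn
      · simp only [t', if_neg hNn]
        exact ht₁ n hn
    have hev := ((hnear N).mono (hWR N)).eventually_edist_le
      ((ENNReal.ofReal_lt_ofReal_iff (by positivity)).2 hN) (hW N) ht'
    obtain ⟨s₁, hs₁⟩ := eventually_atTop.1 hev
    obtain ⟨s₂, hs₂⟩ := summable_iff_vanishing_norm.1
      (summable_head hfin hbdd (hW 0) hW0 ht N) (δ / 4) (by positivity)
    refine ⟨s₁ ∪ s₂, fun s hs => ?_⟩
    have hhead := hs₂ s (hs.mono_right Finset.subset_union_right)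
    rw [Finset.sum_indicator_eq_sum_filter] at hhead
    set u := s.filter fun n => ¬ n.unpair.1 < N with hu
    have hdisj : Disjoint s₁ u :=
      ((hs.mono_right Finset.subset_union_left).symm).mono_right (Finset.filter_subset _ _)
    -- The sums over `s₁ ∪ u` and `s₁` are both `δ / 4`-close to `v`; their difference is the sum
    -- over `u`.
    have htail : ‖∑ n ∈ u, μ.real (W 0 n) • f (t n)‖ ≤ δ / 4 + δ / 4 := by
      have h1 := (edist_triangle_right _ _ v).trans
        (add_le_add (hs₁ (s₁ ∪ u) Finset.subset_union_left) (hs₁ s₁ le_rfl))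
      rw [← ENNReal.ofReal_add (by positivity) (by positivity), edist_dist,
        ENNReal.ofReal_le_ofReal_iff (by positivity), dist_eq_norm, Finset.sum_union hdisj,
        add_sub_cancel_left] at h1
      refine le_of_eq_of_le (congrArg norm (Finset.sum_congr rfl fun n hn => ?_)) h1
      have hn : N ≤ n.unpair.1 := not_lt.1 (Finset.mem_filter.1 hn).2
      simp only [t', if_pos hn, hWeq N n hn]
    have hsplit := Finset.sum_filter_add_sum_filter_not s (fun n => n.unpair.1 < N)
      fun n => μ.real (W 0 n) • f (t n)
    rw [← hsplit]
    refine (norm_add_le _ _).trans_lt ?_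
    have hhead' : ‖∑ n ∈ s with n.unpair.1 < N, μ.real (W 0 n) • f (t n)‖ < δ / 4 := hhead
    linarith
  · have hy : ∀ y ∈ birkhoffSums μ f (W 0), edist y v ≤ ENNReal.ofReal (ε / 4) := by
      rintro y ⟨t, ht, hty⟩
      have hev := ((hnear 0).mono (hWR 0)).eventually_edist_le
        ((ENNReal.ofReal_lt_ofReal_iff (show 0 < ε / 4 by positivity)).2
          (show ε / 8 * (1 / 2 : ℝ) ^ 0 < ε / 4 by rw [pow_zero]; linarith)) (hW 0) ht
      exact le_of_tendsto (Tendsto.edist hty tendsto_const_nhds) hev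
    refine lt_of_le_of_lt (b := ENNReal.ofReal (ε / 4 + ε / 4)) (Metric.ediam_le ?_)
      ((ENNReal.ofReal_lt_ofReal_iff hε).2 (by linarith))
    intro y hy' z hz
    rw [ENNReal.ofReal_add (by positivity) (by positivity)]
    exact (edist_triangle_right _ _ v).trans (add_le_add (hy y hy') (hy z hz))

end Core

/-! ### Embeddings of families of convex sets. -/

section Embeddings

variable {X : Type*} [NormedAddCommGroup X] [NormedSpace ℝ X]

/-- Families of nonempty sets containing `{0}` and stable under positive combinations. -/
structure IsConeFamily (S : Set (Set X)) : Prop where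
  nonempty : ∀ A ∈ S, A.Nonempty
  zero_mem : {0} ∈ S
  add_smul_mem : ∀ A ∈ S, ∀ C ∈ S, ∀ α β : ℝ, 0 < α → 0 < β → α • A + β • C ∈ S

theorem isConeFamily_cwk : IsConeFamily (cwk X) where
  nonempty _ hA := hA.1
  zero_mem := ⟨singleton_nonempty 0, convex_singleton 0, by simp⟩
  add_smul_mem _ hA _ hC α β _ _ := by
    refine ⟨hA.1.smul_set.add hC.1.smul_set, (hA.2.1.smul α).add (hC.2.1.smul β), ?_⟩
    rw [image_add, image_smul_set, image_smul_set]
    exact (hA.2.2.smul α).add (hC.2.2.smul β)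

theorem isConeFamily_ck : IsConeFamily (ck X) where
  nonempty _ hA := hA.1
  zero_mem := ⟨singleton_nonempty 0, convex_singleton 0, isCompact_singleton⟩
  add_smul_mem _ hA _ hC α β _ _ :=
    ⟨hA.1.smul_set.add hC.1.smul_set, (hA.2.1.smul α).add (hC.2.1.smul β),
      (hA.2.2.smul α).add (hC.2.2.smul β)⟩

variable {Y : Type*} [NormedAddCommGroup Y] [NormedSpace ℝ Y]

/-- Linearity is assumed for positive coefficients only, but measures may vanish: such terms drop
out because `0 • B = {0}` for nonempty `B`. The empty sum needs `j {0} = 0`, which follows from `{0}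
+ {0} = {0}`. -/
theorem map_sum_smul_of_map_add_smul {S : Set (Set X)} (hS : IsConeFamily S) {j : Set X → Y}
    (hj : ∀ A ∈ S, ∀ C ∈ S, ∀ α β : ℝ, 0 < α → 0 < β → j (α • A + β • C) = α • j A + β • j C)
    {ι : Type*} (s : Finset ι) {c : ι → ℝ} (hc : ∀ i, 0 ≤ c i) {B : ι → Set X}
    (hB : ∀ i, B i ∈ S) :
    ∑ i ∈ s, c i • B i ∈ S ∧ j (∑ i ∈ s, c i • B i) = ∑ i ∈ s, c i • j (B i) := by
  classical
  have h0 : (0 : Set X) ∈ S := by rw [← singleton_zero]; exact hS.zero_mem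
  have hj0 : j 0 = 0 := by
    have := hj 0 h0 0 h0 1 1 one_pos one_pos
    simpa using this
  induction s using Finset.induction_on with
  | empty => simpa using ⟨h0, hj0⟩
  | insert i s his ih =>
    obtain ⟨ih1, ih2⟩ := ih
    rw [Finset.sum_insert his, Finset.sum_insert his]
    rcases (hc i).eq_or_lt' with hi | hi
    · rw [hi, zero_smul_set (hS.nonempty _ (hB i)), zero_smul, zero_add, zero_add]
      exact ⟨ih1, ih2⟩
    · have h1 := hS.add_smul_mem _ (hB i) _ ih1 (c i) 1 hi one_pos
      have h2 := hj _ (hB i) _ ih1 (c i) 1 hi one_pos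
      rw [one_smul] at h1
      rw [one_smul, one_smul, ih2] at h2
      exact ⟨h1, h2⟩

/-- A positively linear map on a family of sets that is nonexpansive for the Hausdorff distance
turns simple-Birkhoff integrable multifunctions into Birkhoff integrable functions. -/
theorem SimpleBirkhoffIntegrable.birkhoffIntegrable_comp [CompleteSpace Y] {T : Type*}
    [MeasurableSpace T] {μ : Measure T} {S : Set (Set X)} (hS : IsConeFamily S) {F : T → Set X}
    (hF : ∀ t, F t ∈ S) (h : SimpleBirkhoffIntegrable μ S F) {j : Set X → Y}
    (hj : ∀ A ∈ S, ∀ C ∈ S, ∀ α β : ℝ, 0 < α → 0 < β → j (α • A + β • C) = α • j A + β • j C)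
    (hlip : ∀ A ∈ S, ∀ C ∈ S, edist (j A) (j C) ≤ Metric.hausdorffEDist A C) :
    BirkhoffIntegrable μ fun t => j (F t) := by
  obtain ⟨I, hI, -, h⟩ := h
  refine birkhoffIntegrable_of_riemannSumsNear (v := j I) fun ε hε => ?_
  obtain ⟨P, hP, hfin, hsum⟩ := h ε hε
  refine ⟨P, hP, hfin, fun A hA hAP t ht => ?_⟩
  refine (limsup_le_limsup (Eventually.of_forall fun n => ?_)).trans (hsum A hA hAP t ht)
  obtain ⟨h1, h2⟩ := map_sum_smul_of_map_add_smul hS hj (Finset.range n)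
    (fun i => measureReal_nonneg (μ := μ) (s := A i)) fun i => hF (t i)
  rw [← h2, minkowskiSum, Metric.hausdorffEDist_closure_left]
  exact hlip _ h1 _ hI

theorem bddAbove_image_of_mem_cwk {A : Set X} (hA : A ∈ cwk X) (φ : StrongDual ℝ X) :
    BddAbove (φ '' A) := by
  obtain ⟨M, hM⟩ := exists_norm_le_of_mem_cwk hA
  refine ⟨‖φ‖ * M, ?_⟩
  rintro _ ⟨a, ha, rfl⟩
  exact (le_abs_self _).trans ((φ.le_opNorm a).trans
    (mul_le_mul_of_nonneg_left (hM a ha) (norm_nonneg φ)))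

theorem supportEmbedding_add_smul {A C : Set X} (hA : A ∈ cwk X) (hC : C ∈ cwk X) {α β : ℝ}
    (hα : 0 < α) (hβ : 0 < β) :
    supportEmbedding (α • A + β • C) = α • supportEmbedding A + β • supportEmbedding C := by
  ext φ
  have hsum := isConeFamily_cwk.add_smul_mem A hA C hC α β hα hβ
  simp only [lp.coeFn_add, lp.coeFn_smul, Pi.add_apply, Pi.smul_apply]
  rw [supportEmbedding_apply_of_mem_cwk hsum, supportEmbedding_apply_of_mem_cwk hA,
    supportEmbedding_apply_of_mem_cwk hC, image_add, image_smul_set, image_smul_set,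
    csSup_add (hA.1.image _).smul_set ((bddAbove_image_of_mem_cwk hA _).smul_of_nonneg hα.le)
      (hC.1.image _).smul_set ((bddAbove_image_of_mem_cwk hC _).smul_of_nonneg hβ.le),
    Real.sSup_smul_of_nonneg hα.le, Real.sSup_smul_of_nonneg hβ.le]

/-- Each point of `A` is within `r` of a point of `C`, and `φ` is 1-Lipschitz. -/
theorem sSup_image_le_add_of_hausdorffEDist_lt {A C : Set X} (hA : A ∈ cwk X) (hC : C ∈ cwk X)
    {r : ℝ} (h : Metric.hausdorffEDist A C < ENNReal.ofReal r) {φ : StrongDual ℝ X}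
    (hφ : ‖φ‖ ≤ 1) : sSup (φ '' A) ≤ sSup (φ '' C) + r := by
  refine csSup_le (hA.1.image _) ?_
  rintro _ ⟨a, ha, rfl⟩
  obtain ⟨c, hc, hac⟩ := Metric.exists_edist_lt_of_hausdorffEDist_lt ha h
  rw [edist_dist, ENNReal.ofReal_lt_ofReal_iff', dist_eq_norm] at hac
  have h1 : φ c ≤ sSup (φ '' C) := le_csSup (bddAbove_image_of_mem_cwk hC φ) ⟨c, hc, rfl⟩
  have h2 : φ (a - c) ≤ ‖a - c‖ :=
    (le_abs_self _).trans ((φ.le_opNorm _).trans (mul_le_of_le_one_left (norm_nonneg _) hφ))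
  rw [map_sub] at h2
  linarith [hac.1]

theorem edist_supportEmbedding_le {A C : Set X} (hA : A ∈ cwk X) (hC : C ∈ cwk X) :
    edist (supportEmbedding A) (supportEmbedding C) ≤ Metric.hausdorffEDist A C := by
  refine le_of_forall_gt_imp_ge_of_dense fun r hr => ?_
  rcases eq_or_ne r ∞ with rfl | hr'
  · exact le_top
  rw [← ENNReal.ofReal_toReal hr'] at hr ⊢
  rw [edist_dist]
  refine ENNReal.ofReal_le_ofReal ?_
  rw [dist_eq_norm]
  refine lp.norm_le_of_forall_le ENNReal.toReal_nonneg fun φ => ?_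
  have hφ : ‖(φ : StrongDual ℝ X)‖ ≤ 1 := mem_closedBall_zero_iff.1 φ.2
  rw [lp.coeFn_sub, Pi.sub_apply, supportEmbedding_apply_of_mem_cwk hA,
    supportEmbedding_apply_of_mem_cwk hC, Real.norm_eq_abs, abs_sub_le_iff]
  have h1 := sSup_image_le_add_of_hausdorffEDist_lt hA hC hr hφ
  rw [Metric.hausdorffEDist_comm] at hr
  have h2 := sSup_image_le_add_of_hausdorffEDist_lt hC hA hr hφ
  constructor <;> linarith

theorem IsRadstromEmbedding.edist_le {Ω : Type*} [TopologicalSpace Ω] [CompactSpace Ω]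
    {S : Set (Set X)} {j : Set X → C(Ω, ℝ)} (hj : IsRadstromEmbedding S j) {A C : Set X}
    (hA : A ∈ S) (hC : C ∈ S) : edist (j A) (j C) ≤ Metric.hausdorffEDist A C := by
  rw [edist_dist, dist_eq_norm, ← hj.isometry A hA C hC]
  -- Only an inequality is needed, so finiteness of the Hausdorff distance need not be checked.
  exact ENNReal.ofReal_toReal_le

end Embeddings

end SimpleBirkhoff

theorem mainTheorem4 {T : Type*} [MeasurableSpace T] (μ : Measure T) [SigmaFinite μ]
    {X : Type*} [NormedAddCommGroup X] [NormedSpace ℝ X] [CompleteSpace X] (F : T → Set X) :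
    ((∀ t, F t ∈ SimpleBirkhoff.cwk X) →
      SimpleBirkhoff.SimpleBirkhoffIntegrable μ (SimpleBirkhoff.cwk X) F →
        SimpleBirkhoff.MultiBirkhoffIntegrable μ F ∧
        ∀ (Ω : Type*) [TopologicalSpace Ω] [CompactSpace Ω] [T2Space Ω] (j : Set X → C(Ω, ℝ)),
          SimpleBirkhoff.IsRadstromEmbedding (SimpleBirkhoff.cwk X) j →
            SimpleBirkhoff.BirkhoffIntegrable μ fun t => j (F t)) ∧
    ((∀ t, F t ∈ SimpleBirkhoff.ck X) →
      SimpleBirkhoff.SimpleBirkhoffIntegrable μ (SimpleBirkhoff.ck X) F →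
        SimpleBirkhoff.MultiBirkhoffIntegrable μ F ∧
        ∀ (Ω : Type*) [TopologicalSpace Ω] [CompactSpace Ω] [T2Space Ω] (j : Set X → C(Ω, ℝ)),
          SimpleBirkhoff.IsRadstromEmbedding (SimpleBirkhoff.ck X) j →
            SimpleBirkhoff.BirkhoffIntegrable μ fun t => j (F t)) := by
  refine ⟨fun hF h => ⟨?_, fun Ω _ _ _ j hj => ?_⟩, fun hF h => ⟨?_, fun Ω _ _ _ j hj => ?_⟩⟩
  · exact h.birkhoffIntegrable_comp SimpleBirkhoff.isConeFamily_cwk hF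
      (fun A hA C hC α β hα hβ => SimpleBirkhoff.supportEmbedding_add_smul hA hC hα hβ)
      fun A hA C hC => SimpleBirkhoff.edist_supportEmbedding_le hA hC
  · exact h.birkhoffIntegrable_comp SimpleBirkhoff.isConeFamily_cwk hF hj.map_add_smul
      fun A hA C hC => hj.edist_le hA hC
  · exact h.birkhoffIntegrable_comp SimpleBirkhoff.isConeFamily_ck hF
      (fun A hA C hC α β hα hβ => SimpleBirkhoff.supportEmbedding_add_smul
        (SimpleBirkhoff.ck_subset_cwk hA) (SimpleBirkhoff.ck_subset_cwk hC) hα hβ)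
      fun A hA C hC => SimpleBirkhoff.edist_supportEmbedding_le
        (SimpleBirkhoff.ck_subset_cwk hA) (SimpleBirkhoff.ck_subset_cwk hC)
  · exact h.birkhoffIntegrable_comp SimpleBirkhoff.isConeFamily_ck hF hj.map_add_smul
      fun A hA C hC => hj.edist_le hA hC
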